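/- Let $k\ge 1$ and let $\Sigma=\{\sigma_1,\dots,\sigma_k\}$. Let $\mathrm{RE}$ be the set of regular expressions over $\Sigma$ generated by the grammar $$\beta := \varepsilon \mid \sigma\in\Sigma \mid (\beta+\beta)\mid(\beta\cdot\beta)\mid(\beta^\star),$$ where the size of an expression is its number of symbols, parentheses not counted. Let $\mathrm{RE}_{na}\subseteq \mathrm{RE}$ be the set of those expressions that have no subexpression $(\alpha_1+\alpha_2)$ in which $\alpha_1$ or $\alpha_2$ is of the form $(\sigma_{i_1}+\cdots+\sigma_{i_k})^\star$, with any bracketing of the sum, where $\sigma_{i_1},\dots,\sigma_{i_k}$ is a permutation of $\Sigma$. Let $[z^n]B_k(z)$ and $[z^n]R_k(z)$ be the numbers of expressions of size $n$ in $\mathrm{RE}$ and in $\mathrm{RE}_{na}$, respectively. Put $$C_k=\binom{2k-2}{k-1}(k-1)!,\qquad \rho_k=\frac{1}{1+\sqrt{8+8k}},$$ $$\Delta_k(z)=1-2z-(7+8k)z^2+4z^{2k+1}C_k\left(1-z-C_kz^{2k+1}\right).$$ Then $\Delta_k$ has exactly one root $\eta_k$ in the open interval $\left(0,\frac{1}{\sqrt{8+8k}}\right)$,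 there is a polynomial $\psi_k\in\mathbb{R}[z]$ with $\Delta_k(z)=\left(1-\frac{z}{\eta_k}\right)\psi_k(z)$, and one has $\psi_k(\eta_k)>0$ and $\rho_k<\eta_k$. Moreover, as $n\to\infty$, $$\frac{[z^n]R_k(z)}{[z^n]B_k(z)}\;\sim\;\frac{\dfrac{\sqrt{\psi_k(\eta_k)}}{8\eta_k\sqrt{\pi}}\,n^{-3/2}\,\eta_k^{-n}}{\dfrac{\sqrt{2-2\rho_k}}{8\rho_k\sqrt{\pi}}\,n^{-3/2}\,\rho_k^{-n}}\;=\;\frac{\sqrt{\psi_k(\eta_k)}}{\sqrt{2-2\rho_k}}\left(\frac{\rho_k}{\eta_k}\right)^{n+1},$$ and consequently $\dfrac{[z^n]R_k(z)}{[z^n]B_k(z)}\to 0$ as $n\to\infty$. -/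

import Mathlib

open Filter Topology Asymptotics Polynomial

/-- Regular expressions over the alphabet `Fin k` (that is, `{σ₁, …, σₖ}`), as terms of the grammar
`β := ε ∣ σ ∣ (β + β) ∣ (β · β) ∣ (β⋆)`. -/
inductive RegExp (k : ℕ) : Type where
  | eps : RegExp k
  | letter : Fin k → RegExp k
  | union : RegExp k → RegExp k → RegExp k
  | concat : RegExp k → RegExp k → RegExp k
  | star : RegExp k → RegExp k

namespace RegExp

/-- The tree size: the number of symbols, parentheses not counted. -/
def size {k : ℕ} : RegExp k → ℕ
  | eps => 1
  | letter _ => 1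
  | union α β => size α + size β + 1
  | concat α β => size α + size β + 1
  | star α => size α + 1

/-- The letters of an expression, read from left to right, with repetitions. -/
def letters {k : ℕ} : RegExp k → List (Fin k)
  | eps => []
  | letter s => [s]
  | union α β => letters α ++ letters β
  | concat α β => letters α ++ letters β
  | star α => letters α

/-- The expression is a sum of letters (with some bracketing), i.e. is built from letters using
only `+`; a single letter is a sum with one summand. -/
def IsLetterSum {k : ℕ} : RegExp k → Prop
  | eps => False
  | letter _ => True
  | union α β => IsLetterSum α ∧ IsLetterSum β
  | concat _ _ => False
  | star _ => False

/-- The expression is one of the absorbing patterns `Σ⋆`: it is `(σ_{i₁} + ⋯ + σ_{iₖ})⋆`, with any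
bracketing of the sum, where `σ_{i₁}, …, σ_{iₖ}` is a permutation of the alphabet. -/
def IsSigmaStar {k : ℕ} (α : RegExp k) : Prop :=
  ∃ β : RegExp k, α = star β ∧ IsLetterSum β ∧ List.Perm (letters β) (List.finRange k)

/-- `Σ⋆` does not occur in a union: no subexpression `α + β` has a pattern `Σ⋆` as one of its two
operands. -/
def NoSigmaStarInUnion {k : ℕ} : RegExp k → Prop
  | eps => True
  | letter _ => True
  | union α β =>
      NoSigmaStarInUnion α ∧ NoSigmaStarInUnion β ∧ ¬ IsSigmaStar α ∧ ¬ IsSigmaStar β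
  | concat α β => NoSigmaStarInUnion α ∧ NoSigmaStarInUnion β
  | star α => NoSigmaStarInUnion α

/-- `[zⁿ] B_k(z)`: the number of regular expressions of size `n` over `k` letters. -/
noncomputable def countRE (k n : ℕ) : ℕ :=
  Set.ncard {β : RegExp k | size β = n}

/-- `[zⁿ] R_k(z)`: the number of regular expressions of size `n` over `k` letters in which `Σ⋆`
does not occur in a union. -/
noncomputable def countREna (k n : ℕ) : ℕ :=
  Set.ncard {α : RegExp k | NoSigmaStarInUnion α ∧ size α = n}

/-- `C_k = binom(2k-2, k-1) (k-1)!`, used for `k ≥ 1` only. -/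
def patternCount (k : ℕ) : ℕ := Nat.choose (2 * k - 2) (k - 1) * Nat.factorial (k - 1)

/-- `p_k(z) = 1 - 2z - (7 + 8k) z²`. -/
noncomputable def pPoly (k : ℕ) : ℝ[X] := 1 - 2 * X - C (7 + 8 * (k : ℝ)) * X ^ 2

/-- `h_k(z) = 1 - z - C_k z^(2k+1)`. -/
noncomputable def hPoly (k : ℕ) : ℝ[X] := 1 - X - C (patternCount k : ℝ) * X ^ (2 * k + 1)

/-- `Δ_k(z) = p_k(z) + 4 z^(2k+1) C_k h_k(z)`. -/
noncomputable def discr (k : ℕ) : ℝ[X] :=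
  pPoly k + 4 * X ^ (2 * k + 1) * C (patternCount k : ℝ) * hPoly k

/-- `ρ_k = 1 / (1 + √(8 + 8k))`. -/
noncomputable def rho (k : ℕ) : ℝ := 1 / (1 + Real.sqrt (8 + 8 * (k : ℝ)))

end RegExp

/-! Sorting expressions by their outermost operation gives quadratic equations for the generating
series: `B = z(k + 1 + 2B² + B)` and `R = z(k + 1 + (R - P)² + R² + R)`. Here `P = C_k z^(2k)`
counts the patterns Σ⋆. They all have size `2k`, and there are `k!` orders of the letters times a
Catalan number of bracketings. Completing the square turns the equations into `(1 - z - 4zB)² = p_k`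
and `(1 - z + 2zP - 4zR)² = Δ_k` (`sq_eq_pPoly`, `sq_eq_discr`), so up to finitely many terms the
counts are coefficients of square roots of polynomials.

Such a polynomial is `(1 - z/η)ψ` with `ψ` free of zeros in the closed disc of radius `η`. Hence
`√ψ` converges absolutely on a larger disc, and the coefficients of the square root are asymptotic
to `√ψ(η) η^(-n)` times those of `√(1 - z)` (`tendsto_coeff_of_sq_eq`). In the quotient of the two
counts the coefficients of `√(1 - z)` cancel, so the law `n^(-3/2)` is never needed.

It remains to locate the roots. On the interval in question `C_k z^(2k) ≤ z²`, so `Δ_k` is a small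
perturbation of `p_k`: it decreases strictly, is positive at `ρ_k` and negative at the right end.
That `η` is the only complex root of modulus at most `η` (`eq_of_aeval_discr_eq_zero`) follows by
writing `Δ_k` as a difference `a(z)² - 8z²(k + 1 + P²)` with `a = 1 - z + 2zP`. At a root, the
triangle inequality gives `|a(z)| ≤ a(η)`, whereas `Re a(z) > a(η)` for every other point of the
disc. -/

namespace RegExp

/-! ### Finiteness, and the recursion on the outermost operation -/

theorem size_pos {k : ℕ} (β : RegExp k) : 0 < size β := by
  cases β <;> simp [size]

/-- Finiteness makes `Set.ncard` a genuine count, since `Set.ncard` is 0 on infinite sets. -/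
theorem finite_setOf_size_le (k n : ℕ) : {β : RegExp k | size β ≤ n}.Finite := by
  induction n with
  | zero =>
    refine Set.Finite.subset Set.finite_empty fun β hβ => ?_
    have := size_pos β
    simp only [Set.mem_ofPred_eq] at hβ
    omega
  | succ n ih =>
    refine Set.Finite.subset ((((Set.finite_singleton eps).union
      (Set.finite_range letter)).union (ih.image2 union ih)).union
      ((ih.image2 concat ih).union (ih.image star))) fun β hβ => ?_
    simp only [Set.mem_ofPred_eq] at hβ
    cases β with
    | eps => simp
    | letter s => simp
    | union α β =>
      simp only [size] at hβ
      exact .inl (.inr ⟨α, by simp only [Set.mem_ofPred_eq]; omega, β,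
        by simp only [Set.mem_ofPred_eq]; omega, rfl⟩)
    | concat α β =>
      simp only [size] at hβ
      exact .inr (.inl ⟨α, by simp only [Set.mem_ofPred_eq]; omega, β,
        by simp only [Set.mem_ofPred_eq]; omega, rfl⟩)
    | star α =>
      simp only [size] at hβ
      exact .inr (.inr ⟨α, by simp only [Set.mem_ofPred_eq]; omega, rfl⟩)

theorem finite_setOf_and_size_eq {k : ℕ} (Q : RegExp k → Prop) (n : ℕ) :
    {β : RegExp k | Q β ∧ size β = n}.Finite :=
  (finite_setOf_size_le k n).subset fun _ h => h.2.le

/-- The finite set of the expressions of size `n` that satisfy `Q`. -/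
noncomputable def ofSize {k : ℕ} (Q : RegExp k → Prop) (n : ℕ) : Finset (RegExp k) :=
  (finite_setOf_and_size_eq Q n).toFinset

@[simp] theorem mem_ofSize {k : ℕ} {Q : RegExp k → Prop} {n : ℕ} {β : RegExp k} :
    β ∈ ofSize Q n ↔ Q β ∧ size β = n := by
  simp [ofSize]

theorem ncard_setOf_and_size_eq {k : ℕ} (Q : RegExp k → Prop) (n : ℕ) :
    {β : RegExp k | Q β ∧ size β = n}.ncard = (ofSize Q n).card :=
  Set.ncard_eq_toFinset_card _ (finite_setOf_and_size_eq Q n)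

theorem countRE_eq_card (k n : ℕ) : countRE k n = (ofSize (fun _ : RegExp k => True) n).card := by
  simp [countRE, ← ncard_setOf_and_size_eq]

theorem countREna_eq_card (k n : ℕ) :
    countREna k n = (ofSize (NoSigmaStarInUnion (k := k)) n).card :=
  ncard_setOf_and_size_eq _ _

theorem card_ofSize_zero {k : ℕ} (Q : RegExp k → Prop) : (ofSize Q 0).card = 0 := by
  rw [Finset.card_eq_zero, Finset.eq_empty_iff_forall_notMem]
  intro β hβ
  have := size_pos β
  have := (mem_ofSize.1 hβ).2
  omega

open Classical in
/-- The pairs of expressions satisfying `Q` whose sizes add up to `n`. -/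
noncomputable def pairsOfSize {k : ℕ} (Q : RegExp k → Prop) (n : ℕ) :
    Finset (RegExp k × RegExp k) :=
  (Finset.HasAntidiagonal.antidiagonal n).biUnion fun p => ofSize Q p.1 ×ˢ ofSize Q p.2

theorem mem_pairsOfSize {k : ℕ} {Q : RegExp k → Prop} {n : ℕ} {p : RegExp k × RegExp k} :
    p ∈ pairsOfSize Q n ↔ Q p.1 ∧ Q p.2 ∧ size p.1 + size p.2 = n := by
  simp only [pairsOfSize, Finset.mem_biUnion, Finset.HasAntidiagonal.mem_antidiagonal, Finset.mem_product,
    mem_ofSize, Prod.exists]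
  constructor
  · rintro ⟨a, b, h, ⟨h1, h2⟩, h3, h4⟩
    exact ⟨h1, h3, by omega⟩
  · rintro ⟨h1, h2, h3⟩
    exact ⟨_, _, h3, ⟨h1, rfl⟩, h2, rfl⟩

theorem card_pairsOfSize {k : ℕ} (Q : RegExp k → Prop) (n : ℕ) :
    (pairsOfSize Q n).card =
      ∑ p ∈ Finset.HasAntidiagonal.antidiagonal n, (ofSize Q p.1).card * (ofSize Q p.2).card := by
  classical
  rw [pairsOfSize, Finset.card_biUnion]
  · simp
  · intro p _ q _ hpq
    rw [Function.onFun, Finset.disjoint_left]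
    rintro ⟨a, b⟩ h1 h2
    simp only [Finset.mem_product, mem_ofSize] at h1 h2
    exact hpq (Prod.ext (h1.1.2.symm.trans h2.1.2) (h1.2.2.symm.trans h2.2.2))

/-- The recursion for the number of expressions that satisfy a predicate defined by recursion on
expressions: the operands of unions satisfy `U`, those of concatenations and stars `Q`. -/
theorem card_ofSize_succ {k : ℕ} {Q U : RegExp k → Prop} (heps : Q eps)
    (hletter : ∀ s, Q (letter s)) (hunion : ∀ α β, Q (union α β) ↔ U α ∧ U β)
    (hconcat : ∀ α β, Q (concat α β) ↔ Q α ∧ Q β) (hstar : ∀ α, Q (star α) ↔ Q α) (n : ℕ) :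
    (ofSize Q (n + 1)).card = (if n = 0 then k + 1 else 0) +
      (∑ p ∈ Finset.HasAntidiagonal.antidiagonal n, (ofSize U p.1).card * (ofSize U p.2).card) +
      (∑ p ∈ Finset.HasAntidiagonal.antidiagonal n, (ofSize Q p.1).card * (ofSize Q p.2).card) +
      (ofSize Q n).card := by
  classical
  -- The four classes by head constructor. The `k + 1` leaves have size 1, so they occur only for `n
  -- = 0`.
  let A : Finset (RegExp k) := if n = 0 then insert eps (Finset.univ.image letter) else ∅
  let Un := (pairsOfSize U n).image fun p => union p.1 p.2
  let Co := (pairsOfSize Q n).image fun p => concat p.1 p.2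
  let St := (ofSize Q n).image star
  have hA : A.card = if n = 0 then k + 1 else 0 := by
    by_cases hn : n = 0
    · simp only [A, hn, if_true]
      rw [Finset.card_insert_of_notMem (by simp), Finset.card_image_of_injective _
        (fun a b h => by simpa using h)]
      simp
    · simp [A, hn]
  have hUn : Un.card = (pairsOfSize U n).card :=
    Finset.card_image_of_injective _ fun p q h => by
      simp only [union.injEq] at h
      exact Prod.ext h.1 h.2
  have hCo : Co.card = (pairsOfSize Q n).card :=
    Finset.card_image_of_injective _ fun p q h => by
      simp only [concat.injEq] at h
      exact Prod.ext h.1 h.2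
  have hSt : St.card = (ofSize Q n).card :=
    Finset.card_image_of_injective _ fun p q h => by simpa using h
  have key : ofSize Q (n + 1) = ((A ∪ Un) ∪ Co) ∪ St := by
    ext β
    have hAmem : β ∈ A ↔ n = 0 ∧ (β = eps ∨ ∃ s, letter s = β) := by
      by_cases hn : n = 0 <;> simp [A, hn]
    simp only [Finset.mem_union, hAmem, Un, Co, St, Finset.mem_image, mem_ofSize,
      mem_pairsOfSize, Prod.exists]
    cases β with
    | eps => simp [size, heps, eq_comm]
    | letter s => simp [size, hletter, eq_comm]
    | union α β => simp [size, hunion, and_assoc]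
    | concat α β => simp [size, hconcat, and_assoc]
    | star α => simp [size, hstar]
  have d1 : Disjoint A Un := by
    rw [Finset.disjoint_left]
    by_cases hn : n = 0 <;> simp [A, Un, hn]
  have d2 : Disjoint (A ∪ Un) Co := by
    rw [Finset.disjoint_left]
    intro β hβ
    by_cases hn : n = 0 <;> simp [A, Un, Co, hn] at hβ ⊢
    · rcases hβ with rfl | ⟨s, rfl⟩ | ⟨a, b, h, rfl⟩ <;> simp
    · rcases hβ with ⟨a, b, h, rfl⟩; simp
  have d3 : Disjoint ((A ∪ Un) ∪ Co) St := by
    rw [Finset.disjoint_left]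
    intro β hβ
    by_cases hn : n = 0 <;> simp [A, Un, Co, St, hn] at hβ ⊢
    · rcases hβ with rfl | ⟨s, rfl⟩ | ⟨a, b, h, rfl⟩ | ⟨a, b, h, rfl⟩ <;> simp
    · rcases hβ with ⟨a, b, h, rfl⟩ | ⟨a, b, h, rfl⟩ <;> simp
  rw [key, Finset.card_union_of_disjoint d3, Finset.card_union_of_disjoint d2,
    Finset.card_union_of_disjoint d1, hA, hUn, hCo, hSt, card_pairsOfSize, card_pairsOfSize]

/-! ### Counting the patterns -/

theorem IsLetterSum.letters_ne_nil {k : ℕ} {β : RegExp k} (h : IsLetterSum β) :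
    letters β ≠ [] := by
  induction β with
  | letter s => simp [letters]
  | union α β iα iβ => simp [letters, iα h.1]
  | _ => exact h.elim

theorem IsLetterSum.size_add_one {k : ℕ} {β : RegExp k} (h : IsLetterSum β) :
    size β + 1 = 2 * (letters β).length := by
  induction β with
  | letter s => simp [letters, size]
  | union α β iα iβ =>
    have := iα h.1
    have := iβ h.2
    simp only [letters, size, List.length_append]
    omega
  | _ => exact h.elim

theorem IsLetterSum.noSigmaStarInUnion {k : ℕ} {β : RegExp k} (h : IsLetterSum β) :
    NoSigmaStarInUnion β ∧ ¬ IsSigmaStar β := by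
  induction β with
  | letter s => exact ⟨trivial, by rintro ⟨_, h, _⟩; cases h⟩
  | union α β iα iβ =>
    exact ⟨⟨(iα h.1).1, (iβ h.2).1, (iα h.1).2, (iβ h.2).2⟩, by rintro ⟨_, h, _⟩; cases h⟩
  | _ => exact h.elim

theorem IsSigmaStar.noSigmaStarInUnion {k : ℕ} {α : RegExp k} (h : IsSigmaStar α) :
    NoSigmaStarInUnion α := by
  obtain ⟨β, rfl, hβ, -⟩ := h
  exact hβ.noSigmaStarInUnion.1

/-- There are `k` letters, `k - 1` plus signs and one star. A single size for all patterns is what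
makes their generating function a monomial. -/
theorem IsSigmaStar.size_eq {k : ℕ} {α : RegExp k} (h : IsSigmaStar α) : size α = 2 * k := by
  obtain ⟨β, rfl, hβ, hp⟩ := h
  rw [size, hβ.size_add_one, hp.length_eq, List.length_finRange]

/-- The sums of letters with a given list of summands. -/
def sumsOf {k : ℕ} (l : List (Fin k)) : Set (RegExp k) := {β | IsLetterSum β ∧ letters β = l}

theorem finite_sumsOf {k : ℕ} (l : List (Fin k)) : (sumsOf l).Finite :=
  (finite_setOf_size_le k (2 * l.length)).subset fun β hβ => by
    have := hβ.1.size_add_one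
    rw [hβ.2] at this
    simp only [Set.mem_ofPred_eq]
    omega

/-- The number of bracketings of a sum of `n + 1` letters is a Catalan number. -/
theorem ncard_sumsOf {k : ℕ} (n : ℕ) (l : List (Fin k)) (hl : l.length = n + 1) :
    (sumsOf l).ncard = catalan n := by
  classical
  induction n using Nat.strong_induction_on generalizing l with
  | _ n ih =>
  match n with
  | 0 =>
    obtain ⟨s, rfl⟩ := List.length_eq_one_iff.1 hl
    have : sumsOf [s] = {letter s} := by
      ext β
      simp only [sumsOf, Set.mem_ofPred_eq, Set.mem_singleton_iff]
      constructor
      · rintro ⟨h1, h2⟩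
        cases β with
        | letter t => simpa [letters] using h2
        | union α β =>
          have h3 := congrArg List.length h2
          have h4 := List.length_pos_iff.2 h1.1.letters_ne_nil
          have h5 := List.length_pos_iff.2 h1.2.letters_ne_nil
          simp only [letters, List.length_append, List.length_singleton] at h3
          omega
        | _ => exact h1.elim
      · rintro rfl
        exact ⟨trivial, rfl⟩
    simp [this]
  | n + 1 =>
    -- A bracketing of `n + 2` letters is determined by where its outermost `+` cuts the word and by
    -- bracketings of the two nonempty pieces. This is the Catalan recursion; the shifts by 1 encode
    -- nonemptiness.
    have key : (finite_sumsOf l).toFinset = (Finset.HasAntidiagonal.antidiagonal n).biUnion fun p =>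
        ((finite_sumsOf (l.take (p.1 + 1))).toFinset ×ˢ
          (finite_sumsOf (l.drop (p.1 + 1))).toFinset).image fun q => union q.1 q.2 := by
      ext β
      simp only [Set.Finite.mem_toFinset, Finset.mem_biUnion, Finset.HasAntidiagonal.mem_antidiagonal,
        Finset.mem_image, Finset.mem_product, Prod.exists, sumsOf, Set.mem_ofPred_eq]
      constructor
      · rintro ⟨h1, h2⟩
        cases β with
        | letter t =>
          have := congrArg List.length h2
          simp [letters, hl] at this
        | union α β =>
          have h3 := congrArg List.length h2
          have h4 := List.length_pos_iff.2 h1.1.letters_ne_nil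
          have h5 := List.length_pos_iff.2 h1.2.letters_ne_nil
          simp only [letters, List.length_append] at h2 h3
          refine ⟨(letters α).length - 1, (letters β).length - 1, by omega, α, β, ⟨⟨h1.1, ?_⟩,
            h1.2, ?_⟩, rfl⟩
          · rw [← h2, Nat.sub_add_cancel h4, List.take_left]
          · rw [← h2, Nat.sub_add_cancel h4, List.drop_left]
        | _ => exact h1.elim
      · rintro ⟨i, j, hij, α, β, ⟨⟨h1, h2⟩, h3, h4⟩, rfl⟩
        exact ⟨⟨h1, h3⟩, by rw [letters, h2, h4, List.take_append_drop]⟩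
    rw [Set.ncard_eq_toFinset_card _ (finite_sumsOf l), key, Finset.card_biUnion, catalan_succ']
    · refine Finset.sum_congr rfl fun p hp => ?_
      rw [Finset.HasAntidiagonal.mem_antidiagonal] at hp
      rw [Finset.card_image_of_injective _ fun p q h => by
          simp only [union.injEq] at h
          exact Prod.ext h.1 h.2, Finset.card_product, ← Set.ncard_eq_toFinset_card _ (finite_sumsOf _),
        ← Set.ncard_eq_toFinset_card _ (finite_sumsOf _), ih p.1 (by omega) _ (by simp; omega),
        ih p.2 (by omega) _ (by simp; omega)]
    · intro p hp q hq hpq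
      rw [Function.onFun, Finset.disjoint_left]
      intro β h1 h2
      simp only [Finset.mem_image, Finset.mem_product, Set.Finite.mem_toFinset, sumsOf,
        Set.mem_ofPred_eq, Prod.exists] at h1 h2
      obtain ⟨a, b, ⟨⟨-, h1⟩, -⟩, rfl⟩ := h1
      obtain ⟨c, d, ⟨⟨-, h2⟩, -⟩, h⟩ := h2
      simp only [union.injEq] at h
      rw [h.1, h1] at h2
      have := congrArg List.length h2
      simp only [Finset.mem_coe, Finset.HasAntidiagonal.mem_antidiagonal] at hp hq
      simp only [List.length_take] at this
      exact hpq (Prod.ext (by omega) (by omega))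

/-- A pattern is an order of the letters together with a bracketing, and `k! · catalan (k - 1) =
C_k` because `k · catalan (k - 1)` is the central binomial coefficient. -/
theorem card_ofSize_isSigmaStar {k : ℕ} (hk : 1 ≤ k) :
    (ofSize (IsSigmaStar (k := k)) (2 * k)).card = patternCount k := by
  classical
  have key : ofSize (IsSigmaStar (k := k)) (2 * k) =
      (List.finRange k).permutations.toFinset.biUnion fun l =>
        (finite_sumsOf l).toFinset.image star := by
    ext α
    simp only [mem_ofSize, Finset.mem_biUnion, List.mem_toFinset, List.mem_permutations,
      Finset.mem_image, Set.Finite.mem_toFinset, sumsOf, Set.mem_ofPred_eq]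
    constructor
    · rintro ⟨⟨β, rfl, h1, h2⟩, -⟩
      exact ⟨_, h2, β, ⟨h1, rfl⟩, rfl⟩
    · rintro ⟨l, hl, β, ⟨h1, rfl⟩, rfl⟩
      exact ⟨⟨β, rfl, h1, hl⟩, IsSigmaStar.size_eq ⟨β, rfl, h1, hl⟩⟩
  obtain ⟨m, rfl⟩ : ∃ m, k = m + 1 := ⟨k - 1, by omega⟩
  rw [key, Finset.card_biUnion]
  · rw [Finset.sum_congr rfl (g := fun _ => catalan m), Finset.sum_const, smul_eq_mul,
      List.toFinset_card_of_nodup (List.nodup_permutations _ (List.nodup_finRange _)),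
      List.length_permutations, List.length_finRange, patternCount, Nat.factorial_succ]
    · have := succ_mul_catalan_eq_centralBinom m
      rw [Nat.centralBinom] at this
      rw [show 2 * (m + 1) - 2 = 2 * m by omega, Nat.add_sub_cancel, ← this]
      ring
    · intro l hl
      rw [List.mem_toFinset, List.mem_permutations] at hl
      rw [Finset.card_image_of_injective _ fun p q h => by simpa using h,
        ← Set.ncard_eq_toFinset_card _ (finite_sumsOf l), ncard_sumsOf m l (by simp [hl.length_eq])]
  · intro l _ l' _ hll
    rw [Function.onFun, Finset.disjoint_left]
    intro α h1 h2
    simp only [Finset.mem_image, Set.Finite.mem_toFinset, sumsOf, Set.mem_ofPred_eq] at h1 h2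
    obtain ⟨β, ⟨-, h1⟩, rfl⟩ := h1
    obtain ⟨γ, ⟨-, h2⟩, h⟩ := h2
    simp only [star.injEq] at h
    exact hll (by rw [← h1, ← h2, h])

/-- A pattern contains no union with a starred operand, so the patterns form a subset of `RE_na`.
Removing them to obtain the admissible operands of unions is therefore an exact subtraction. -/
theorem card_ofSize_noSigmaStar {k : ℕ} (hk : 1 ≤ k) (n : ℕ) :
    (ofSize (fun α : RegExp k => NoSigmaStarInUnion α ∧ ¬ IsSigmaStar α) n).card +
      (if n = 2 * k then patternCount k else 0) = countREna k n := by
  classical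
  have h1 : (if n = 2 * k then patternCount k else 0) = (ofSize (IsSigmaStar (k := k)) n).card := by
    split_ifs with h
    · rw [h, card_ofSize_isSigmaStar hk]
    · rw [eq_comm, Finset.card_eq_zero, Finset.eq_empty_iff_forall_notMem]
      intro α hα
      rw [mem_ofSize] at hα
      exact h (hα.2 ▸ hα.1.size_eq)
  rw [h1, countREna_eq_card, ← Finset.card_union_of_disjoint]
  · congr 1
    ext α
    have := @IsSigmaStar.noSigmaStarInUnion k α
    simp only [Finset.mem_union, mem_ofSize]
    tauto
  · rw [Finset.disjoint_left]
    intro α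
    simp only [mem_ofSize]
    tauto

/-! ### The functional equations -/

/-- The generating series of all expressions. -/
noncomputable def seriesRE (k : ℕ) : PowerSeries ℝ := PowerSeries.mk fun n => (countRE k n : ℝ)

/-- The generating series of the expressions without `Σ⋆` in a union. -/
noncomputable def seriesREna (k : ℕ) : PowerSeries ℝ := PowerSeries.mk fun n => (countREna k n : ℝ)

theorem seriesRE_eq (k : ℕ) :
    seriesRE k = PowerSeries.X * (PowerSeries.C ((k : ℝ) + 1) + seriesRE k ^ 2 + seriesRE k ^ 2 +
      seriesRE k) := by
  ext n
  cases n with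
  | zero => simp [seriesRE, countRE_eq_card, card_ofSize_zero]
  | succ n =>
    have h := card_ofSize_succ (k := k) (Q := fun _ => True) (U := fun _ => True) trivial
      (fun _ => trivial) (by simp) (by simp) (by simp) n
    simp only [← countRE_eq_card] at h
    rw [PowerSeries.coeff_succ_X_mul]
    simp only [map_add, sq, PowerSeries.coeff_mul, seriesRE, PowerSeries.coeff_mk, h,
      PowerSeries.coeff_C]
    split_ifs <;> push_cast <;> ring

theorem seriesREna_eq {k : ℕ} (hk : 1 ≤ k) :
    seriesREna k = PowerSeries.X * (PowerSeries.C ((k : ℝ) + 1) +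
      (seriesREna k - PowerSeries.C (patternCount k : ℝ) * PowerSeries.X ^ (2 * k)) ^ 2 +
      seriesREna k ^ 2 + seriesREna k) := by
  have hU : seriesREna k - PowerSeries.C (patternCount k : ℝ) * PowerSeries.X ^ (2 * k) =
      PowerSeries.mk fun n =>
        ((ofSize (fun α : RegExp k => NoSigmaStarInUnion α ∧ ¬ IsSigmaStar α) n).card : ℝ) := by
    ext n
    rw [map_sub, seriesREna, PowerSeries.coeff_mk, PowerSeries.coeff_mk,
      ← card_ofSize_noSigmaStar hk, PowerSeries.coeff_C_mul, PowerSeries.coeff_X_pow]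
    push_cast
    split_ifs <;> simp
  rw [hU]
  ext n
  cases n with
  | zero => simp [seriesREna, countREna_eq_card, card_ofSize_zero]
  | succ n =>
    have h := card_ofSize_succ (k := k) (Q := NoSigmaStarInUnion)
      (U := fun α : RegExp k => NoSigmaStarInUnion α ∧ ¬ IsSigmaStar α) trivial
      (fun _ => trivial) (by simp [NoSigmaStarInUnion]; tauto)
      (by simp [NoSigmaStarInUnion]) (by simp [NoSigmaStarInUnion]) n
    simp only [← countREna_eq_card] at h
    rw [PowerSeries.coeff_succ_X_mul]
    simp only [map_add, sq, PowerSeries.coeff_mul, seriesREna, PowerSeries.coeff_mk, h,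
      PowerSeries.coeff_C]
    split_ifs <;> push_cast <;> ring

end RegExp

/-! ### The coefficients of `√(1 - z)` -/

/-- The coefficient of `zⁿ` in `√(1 - z)`. -/
noncomputable def sqrtCoeff (n : ℕ) : ℝ := (-1) ^ n * Ring.choose (1 / 2 : ℝ) n

@[simp] theorem sqrtCoeff_zero : sqrtCoeff 0 = 1 := by simp [sqrtCoeff]

theorem sqrtCoeff_succ (n : ℕ) :
    sqrtCoeff (n + 1) = (2 * n - 1) / (2 * n + 2) * sqrtCoeff n := by
  have h := Ring.choose_smul_choose (1 / 2 : ℝ) (n := n + 1) (k := n) (by omega)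
  rw [Nat.add_sub_cancel_left, Ring.choose_one_right, Nat.choose_succ_self_right,
    nsmul_eq_mul] at h
  have h2 : (2 * n + 2 : ℝ) ≠ 0 := by positivity
  rw [sqrtCoeff, sqrtCoeff, div_mul_eq_mul_div, eq_div_iff h2, pow_succ]
  push_cast at h
  linear_combination (-2 * (-1) ^ n) * h

theorem sqrtCoeff_succ_neg (n : ℕ) : sqrtCoeff (n + 1) < 0 := by
  induction n with
  | zero => norm_num [sqrtCoeff_succ]
  | succ n ih =>
    rw [sqrtCoeff_succ]
    refine mul_neg_of_pos_of_neg (div_pos ?_ (by positivity)) ih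
    push_cast
    have : (0 : ℝ) ≤ n := n.cast_nonneg
    linarith

theorem sqrtCoeff_ne_zero (n : ℕ) : sqrtCoeff n ≠ 0 := by
  cases n with
  | zero => simp
  | succ n => exact (sqrtCoeff_succ_neg n).ne

theorem abs_sqrtCoeff_le_one (n : ℕ) : |sqrtCoeff n| ≤ 1 := by
  induction n with
  | zero => simp
  | succ n ih =>
    have hn : (0 : ℝ) ≤ n := n.cast_nonneg
    rw [sqrtCoeff_succ, abs_mul]
    refine mul_le_one₀ ?_ (abs_nonneg _) ih
    rw [abs_le, le_div_iff₀ (by positivity), div_le_one (by positivity)]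
    constructor <;> linarith

/-- The coefficients decay only polynomially. The exponent 4 is the least integer that works: from
`n = 1` to `n = 2` they shrink by the factor 1/4, and `(3/2)^4 ≥ 4 > (3/2)^3`. -/
theorem monotone_abs_sqrtCoeff_mul :
    Monotone fun n : ℕ => |sqrtCoeff n| * ((n : ℝ) + 1) ^ 4 := by
  refine monotone_nat_of_le_succ fun n => ?_
  rw [sqrtCoeff_succ, abs_mul, abs_div]
  have hn : (0 : ℝ) ≤ n := n.cast_nonneg
  have h2 : (0 : ℝ) < 2 * n + 2 := by positivity
  rw [abs_of_pos h2, div_mul_eq_mul_div, div_mul_eq_mul_div, le_div_iff₀ h2]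
  suffices ((n : ℝ) + 1) ^ 4 * (2 * n + 2) ≤ |2 * (n : ℝ) - 1| * (n + 2) ^ 4 by
    have := mul_le_mul_of_nonneg_left this (abs_nonneg (sqrtCoeff n))
    push_cast
    rw [show (n : ℝ) + 1 + 1 = n + 2 by ring]
    linarith
  rcases Nat.eq_zero_or_pos n with rfl | hpos
  · norm_num
  · have h1 : (1 : ℝ) ≤ n := by exact_mod_cast hpos
    rw [abs_of_nonneg (by linarith)]
    obtain ⟨m, rfl⟩ : ∃ m : ℕ, n = m + 1 := ⟨n - 1, by omega⟩
    push_cast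
    have hm : (0 : ℝ) ≤ m := m.cast_nonneg
    have : 0 ≤ (2 * ((m : ℝ) + 1) - 1) * (m + 1 + 2) ^ 4 -
        ((m : ℝ) + 1 + 1) ^ 4 * (2 * (m + 1) + 2) := by
      ring_nf
      positivity
    linarith

/-- A bound uniform in `n` and polynomial in `j`, for dominated convergence; it combines the
monotonicity above with `n + 1 ≤ (j + 1)(n - j + 1)`. -/
theorem abs_sqrtCoeff_sub_div_le {j n : ℕ} (h : j ≤ n) :
    |sqrtCoeff (n - j) / sqrtCoeff n| ≤ ((j : ℝ) + 1) ^ 4 := by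
  have hpos : 0 < |sqrtCoeff n| := abs_pos.2 (sqrtCoeff_ne_zero n)
  rw [abs_div, div_le_iff₀ hpos]
  obtain ⟨m, rfl⟩ := Nat.exists_eq_add_of_le' h
  rw [Nat.add_sub_cancel]
  have h1 : |sqrtCoeff m| * ((m : ℝ) + 1) ^ 4 ≤ |sqrtCoeff (m + j)| * ((m + j : ℕ) + 1 : ℝ) ^ 4 :=
    monotone_abs_sqrtCoeff_mul (Nat.le_add_right m j)
  have h2 : ((m + j : ℕ) + 1 : ℝ) ^ 4 ≤ ((j : ℝ) + 1) ^ 4 * ((m : ℝ) + 1) ^ 4 := by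
    rw [← mul_pow]
    gcongr
    push_cast
    nlinarith [(m.cast_nonneg : (0 : ℝ) ≤ m), (j.cast_nonneg : (0 : ℝ) ≤ j)]
  have h3 : (0 : ℝ) < ((m : ℝ) + 1) ^ 4 := by positivity
  refine le_of_mul_le_mul_right (h1.trans ?_) h3
  calc |sqrtCoeff (m + j)| * ((m + j : ℕ) + 1 : ℝ) ^ 4
      ≤ |sqrtCoeff (m + j)| * (((j : ℝ) + 1) ^ 4 * ((m : ℝ) + 1) ^ 4) := by gcongr
    _ = _ := by ring

/-- Consecutive coefficients have the quotient `(2n + 2)/(2n - 1) = 1 + 3/(2n - 1)`; longer shifts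
telescope. -/
theorem tendsto_sqrtCoeff_div_add (j : ℕ) :
    Tendsto (fun n => sqrtCoeff n / sqrtCoeff (n + j)) atTop (𝓝 1) := by
  induction j with
  | zero => simp [sqrtCoeff_ne_zero]
  | succ j ih =>
    have h1 : Tendsto (fun n : ℕ => sqrtCoeff n / sqrtCoeff (n + 1)) atTop (𝓝 1) := by
      have h : Tendsto (fun n : ℕ => 1 + 3 / (2 * (n : ℝ) - 1)) atTop (𝓝 (1 + 0)) := by
        refine tendsto_const_nhds.add (tendsto_const_nhds.div_atTop ?_)
        exact tendsto_atTop_add_const_right _ _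
          (tendsto_natCast_atTop_atTop.const_mul_atTop two_pos)
      rw [add_zero] at h
      refine h.congr' ?_
      filter_upwards [eventually_ge_atTop 1] with n hn
      have hn : (1 : ℝ) ≤ n := by exact_mod_cast hn
      have h2 : 2 * (n : ℝ) - 1 ≠ 0 := by linarith
      have := sqrtCoeff_ne_zero n
      rw [sqrtCoeff_succ]
      field_simp
      ring
    have h2 := (h1.comp (tendsto_add_atTop_nat j)).mul ih
    rw [one_mul] at h2
    refine h2.congr fun n => ?_
    have := sqrtCoeff_ne_zero (n + j)
    have := sqrtCoeff_ne_zero (n + j + 1)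
    simp only [Function.comp, ← add_assoc]
    field_simp

theorem tendsto_sqrtCoeff_sub_div (j : ℕ) :
    Tendsto (fun n => sqrtCoeff (n - j) / sqrtCoeff n) atTop (𝓝 1) := by
  refine ((tendsto_sqrtCoeff_div_add j).comp (tendsto_sub_atTop_nat j)).congr' ?_
  filter_upwards [eventually_ge_atTop j] with n hn
  simp only [Function.comp]
  rw [Nat.sub_add_cancel hn]

/-! ### Square roots of polynomials as power series -/

/-- The power series of `√(1 - c z)`. -/
noncomputable def sqrtSeries (c : ℂ) : PowerSeries ℂ :=
  PowerSeries.mk fun n => (sqrtCoeff n : ℂ) * c ^ n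

/-- The series is the binomial series of `(1 + z)^(1/2)` at `-c z`, and exponents add when binomial
series are multiplied. -/
theorem sqrtSeries_sq (c : ℂ) :
    sqrtSeries c ^ 2 = 1 - PowerSeries.C c * PowerSeries.X := by
  have h1 : sqrtSeries c =
      PowerSeries.rescale (-c) (PowerSeries.binomialSeries ℂ (1 / 2 : ℝ)) := by
    ext n
    rw [sqrtSeries, PowerSeries.coeff_mk, PowerSeries.coeff_rescale,
      PowerSeries.binomialSeries_coeff, sqrtCoeff, neg_pow]
    simp only [Complex.real_smul]
    push_cast
    ring
  have h2 : PowerSeries.binomialSeries ℂ (1 / 2 : ℝ) ^ 2 = 1 + PowerSeries.X := by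
    rw [sq, ← PowerSeries.binomialSeries_add]
    have := PowerSeries.binomialSeries_nat (R := ℝ) (A := ℂ) 1
    norm_num at this ⊢
    exact this
  rw [h1, ← map_pow, h2, map_add, map_one, PowerSeries.rescale_X, map_neg, neg_mul, sub_eq_add_neg]

/-- The Cauchy product. It serves both to build `√ψ` from linear factors and to see that the value
of `√ψ` at `η` squares to `ψ(η)`. -/
theorem PowerSeries.summable_norm_coeff_mul {f g : PowerSeries ℂ} {r : ℝ}
    (hf : Summable fun n => ‖coeff n f * (r : ℂ) ^ n‖)
    (hg : Summable fun n => ‖coeff n g * (r : ℂ) ^ n‖) :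
    Summable (fun n => ‖coeff n (f * g) * (r : ℂ) ^ n‖) ∧
    (∑' n, coeff n f * (r : ℂ) ^ n) * (∑' n, coeff n g * (r : ℂ) ^ n) =
      ∑' n, coeff n (f * g) * (r : ℂ) ^ n := by
  have key : ∀ n, ∑ p ∈ Finset.HasAntidiagonal.antidiagonal n,
      (coeff p.1 f * (r : ℂ) ^ p.1) * (coeff p.2 g * (r : ℂ) ^ p.2) =
      coeff n (f * g) * (r : ℂ) ^ n := by
    intro n
    rw [coeff_mul, Finset.sum_mul]
    refine Finset.sum_congr rfl fun p hp => ?_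
    rw [← Finset.HasAntidiagonal.mem_antidiagonal.1 hp, pow_add]
    ring
  constructor
  · simpa only [key] using summable_norm_sum_mul_antidiagonal_of_summable_norm hf hg
  · rw [tsum_mul_tsum_eq_tsum_sum_antidiagonal_of_summable_norm hf hg]
    simp only [key]

/-- A polynomial with constant term `1` and without roots in the closed disc of radius `r` has a
square root whose power series converges absolutely on that disc. -/
theorem Polynomial.exists_sqrt_powerSeries {r : ℝ} (hr : 0 < r) (n : ℕ) (ψ : ℂ[X])
    (hn : ψ.natDegree = n) (h0 : ψ.coeff 0 = 1) (hroot : ∀ z, ψ.eval z = 0 → r < ‖z‖) :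
    ∃ G : PowerSeries ℂ, G ^ 2 = (ψ : PowerSeries ℂ) ∧
      Summable fun n => ‖PowerSeries.coeff n G * (r : ℂ) ^ n‖ := by
  induction n generalizing ψ with
  | zero =>
    refine ⟨1, ?_, ?_⟩
    · rw [Polynomial.eq_C_of_natDegree_eq_zero hn, h0]
      simp
    · refine summable_of_ne_finset_zero (s := {0}) fun n hn => ?_
      rw [Finset.mem_singleton] at hn
      simp [PowerSeries.coeff_one, hn]
  | succ n ih =>
    obtain ⟨z, hz⟩ := IsAlgClosed.exists_root ψ (fun h => by
      have := natDegree_eq_of_degree_eq_some (h.trans (by simp : (0 : WithBot ℕ) = ((0 : ℕ) : _)))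
      omega)
    obtain ⟨q, rfl⟩ := dvd_iff_isRoot.2 hz
    have hz0 : z ≠ 0 := by
      rintro rfl
      simp at h0
    -- The linear factor is normalised to constant term 1, so that its root is a `sqrtSeries` and
    -- the cofactor again has constant term 1.
    have hfac : (X - C z) * q = (1 - C z⁻¹ * X) * (C (-z) * q) := by
      have : (C z : ℂ[X]) * C z⁻¹ = 1 := by rw [← C_mul, mul_inv_cancel₀ hz0, C_1]
      rw [C_neg]
      linear_combination (-X * q) * this
    have hq0 : q ≠ 0 := by
      rintro rfl
      simp at h0
    obtain ⟨G, hG, hs⟩ := ih (C (-z) * q)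
      (by
        rw [natDegree_mul (X_sub_C_ne_zero z) hq0, natDegree_X_sub_C] at hn
        rw [natDegree_C_mul (neg_ne_zero.2 hz0)]
        omega)
      (by
        rw [mul_coeff_zero] at h0 ⊢
        simpa using h0)
      (fun w hw => hroot w (by rw [hfac, eval_mul, hw, mul_zero]))
    refine ⟨sqrtSeries z⁻¹ * G, ?_, (PowerSeries.summable_norm_coeff_mul ?_ hs).1⟩
    · rw [mul_pow, sqrtSeries_sq, hG, hfac]
      simp
    · have hlt : r / ‖z‖ < 1 := (div_lt_one (norm_pos_iff.2 hz0)).2 (hroot z hz)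
      refine Summable.of_nonneg_of_le (fun _ => norm_nonneg _) (fun m => ?_)
        (summable_geometric_of_lt_one (by positivity) hlt)
      rw [sqrtSeries, PowerSeries.coeff_mk, norm_mul, norm_mul, norm_pow, norm_pow, norm_inv,
        Complex.norm_real, Complex.norm_real, Real.norm_eq_abs, Real.norm_eq_abs, abs_of_pos hr,
        div_pow, inv_pow, mul_assoc]
      refine (mul_le_of_le_one_left (by positivity) (abs_sqrtCoeff_le_one m)).trans (le_of_eq ?_)
      rw [div_eq_inv_mul]

/-- The transfer of the asymptotics of `√(1 - z/η)` to its product with a series that converges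
absolutely on a larger disc. -/
theorem tendsto_coeff_sqrtSeries_mul {η r : ℝ} (hη : 0 < η) (hr : η < r) {G : PowerSeries ℂ}
    (hG : Summable fun n => ‖PowerSeries.coeff n G * (r : ℂ) ^ n‖) :
    Tendsto (fun n => PowerSeries.coeff n (sqrtSeries (η : ℂ)⁻¹ * G) * (η : ℂ) ^ n / sqrtCoeff n)
      atTop (𝓝 (∑' j, PowerSeries.coeff j G * (η : ℂ) ^ j)) := by
  have hηC : (η : ℂ) ≠ 0 := by exact_mod_cast hη.ne'
  have hr0 : 0 < r := hη.trans hr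
  -- The `j`-th term of the Cauchy product after normalisation, extended by 0 beyond `n`. Each tends
  -- to `g_j η^j`, and Tannery's theorem exchanges limit and sum.
  let f : ℕ → ℕ → ℂ := fun n j => if j ≤ n then
    PowerSeries.coeff j G * (η : ℂ) ^ j * ((sqrtCoeff (n - j) / sqrtCoeff n : ℝ) : ℂ) else 0
  have hf : ∀ n, PowerSeries.coeff n (sqrtSeries (η : ℂ)⁻¹ * G) * (η : ℂ) ^ n / sqrtCoeff n =
      ∑' j, f n j := by
    intro n
    rw [tsum_eq_sum (s := Finset.range (n + 1)) (fun j hj => by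
      rw [Finset.mem_range, not_lt] at hj
      exact if_neg (by omega)), mul_comm (sqrtSeries _), PowerSeries.coeff_mul,
      Finset.Nat.sum_antidiagonal_eq_sum_range_succ_mk, Finset.sum_mul, Finset.sum_div]
    refine Finset.sum_congr rfl fun j hj => ?_
    have hj : j ≤ n := by rw [Finset.mem_range] at hj; omega
    simp only [f, hj, if_true, sqrtSeries, PowerSeries.coeff_mk]
    have : (η : ℂ) ^ n = (η : ℂ) ^ (n - j) * (η : ℂ) ^ j := by
      rw [← pow_add, Nat.sub_add_cancel hj]
    rw [this, inv_pow]
    have := pow_ne_zero (n - j) hηC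
    push_cast
    field_simp
  -- The geometric gain `(η/r)^j` absorbs the polynomial loss `(j + 1)^4`, so `M |g_j| r^j` is a
  -- summable dominating sequence.
  obtain ⟨M, hM⟩ : ∃ M : ℝ, ∀ j : ℕ, ((j : ℝ) + 1) ^ 4 * (η / r) ^ j ≤ M := by
    have hlt : η / r < 1 := (div_lt_one hr0).2 hr
    have h := tendsto_pow_const_mul_const_pow_of_lt_one 4 (by positivity : 0 ≤ η / r) hlt
    have h' := (h.comp (tendsto_add_atTop_nat 1)).mul_const (η / r)⁻¹
    obtain ⟨M, hM⟩ := h'.bddAbove_range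
    refine ⟨M, fun j => (le_of_eq ?_).trans (hM ⟨j, rfl⟩)⟩
    have : η / r ≠ 0 := by positivity
    simp only [Function.comp]
    push_cast
    rw [pow_succ (η / r), mul_assoc, mul_assoc, mul_inv_cancel₀ this, mul_one]
  simp only [hf]
  refine tendsto_tsum_of_dominated_convergence
    (bound := fun j => M * ‖PowerSeries.coeff j G * (r : ℂ) ^ j‖) (hG.mul_left M) ?_ ?_
  · intro j
    have h := (Complex.continuous_ofReal.tendsto _).comp (tendsto_sqrtCoeff_sub_div j)
    have h' := h.const_mul (PowerSeries.coeff j G * (η : ℂ) ^ j)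
    rw [Complex.ofReal_one, mul_one] at h'
    refine h'.congr' ?_
    filter_upwards [eventually_ge_atTop j] with n hn
    simp [f, hn]
  · refine Eventually.of_forall fun n j => ?_
    have hM0 : 0 ≤ M := zero_le_one.trans (by simpa using hM 0)
    by_cases hj : j ≤ n
    · simp only [f, hj, if_true, norm_mul, norm_pow, Complex.norm_real, Real.norm_eq_abs,
        abs_of_pos hη, abs_of_pos hr0]
      calc ‖PowerSeries.coeff j G‖ * η ^ j * |sqrtCoeff (n - j) / sqrtCoeff n|
          ≤ ‖PowerSeries.coeff j G‖ * η ^ j * ((j : ℝ) + 1) ^ 4 := by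
            gcongr
            exact abs_sqrtCoeff_sub_div_le hj
        _ = (((j : ℝ) + 1) ^ 4 * (η / r) ^ j) * (‖PowerSeries.coeff j G‖ * r ^ j) := by
            rw [div_pow]
            field_simp
        _ ≤ M * (‖PowerSeries.coeff j G‖ * r ^ j) := by
            gcongr
            exact hM j
    · simp only [f, hj, if_false, norm_zero]
      positivity

theorem Polynomial.tsum_coeff_mul_pow (p : ℂ[X]) (z : ℂ) :
    ∑' n, p.coeff n * z ^ n = p.eval z := by
  rw [tsum_eq_sum (s := Finset.range (p.natDegree + 1)), eval_eq_sum_range]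
  intro n hn
  rw [Finset.mem_range, not_lt] at hn
  rw [coeff_eq_zero_of_natDegree_lt (by omega), zero_mul]

/-- Asymptotics of the coefficients of the square root of a polynomial with a simple dominant
root `η`, in comparison with those of `√(1 - z)`. -/
theorem tendsto_coeff_of_sq_eq {ψ : ℝ[X]} {η : ℝ} (hη : 0 < η) (h0 : ψ.coeff 0 = 1)
    (hroot : ∀ z : ℂ, aeval z ψ = 0 → η < ‖z‖) (hpos : 0 < ψ.eval η) {V : PowerSeries ℝ}
    (hV : V ^ 2 = ((1 - C (1 / η) * X) * ψ : ℝ[X]))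
    (hneg : ∀ᶠ n in atTop, PowerSeries.coeff n V ≤ 0) :
    Tendsto (fun n => PowerSeries.coeff n V * η ^ n / sqrtCoeff n) atTop
      (𝓝 (Real.sqrt (ψ.eval η))) := by
  have hψ : ψ ≠ 0 := by
    rintro rfl
    simp at h0
  have hev : ∀ z : ℂ, (ψ.map (algebraMap ℝ ℂ)).eval z = aeval z ψ := fun z => by
    rw [eval_map_algebraMap]
  -- As `ψ` has finitely many roots, all of modulus greater than `η`, a slightly larger radius still
  -- avoids them.
  obtain ⟨r, hr, hr'⟩ : ∃ r, (∀ z ∈ (ψ.map (algebraMap ℝ ℂ)).roots.toFinset, r < ‖z‖) ∧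
      η < r := by
    have h1 : ∀ᶠ r in 𝓝[>] η, ∀ z ∈ (ψ.map (algebraMap ℝ ℂ)).roots.toFinset, r < ‖z‖ := by
      rw [Filter.eventually_all_finset]
      intro z hz
      rw [Multiset.mem_toFinset, mem_roots (by simpa using hψ), IsRoot.def, hev] at hz
      exact nhdsWithin_le_nhds (eventually_lt_nhds (hroot z hz))
    exact (h1.and self_mem_nhdsWithin).exists
  obtain ⟨G, hG, hs⟩ := Polynomial.exists_sqrt_powerSeries (hη.trans hr') _
    (ψ.map (algebraMap ℝ ℂ)) rfl (by simp [h0]) (fun z hz => hr z (by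
      rw [Multiset.mem_toFinset, mem_roots (by simpa using hψ)]
      exact hz))
  have hVC : (PowerSeries.map (algebraMap ℝ ℂ) V) ^ 2 = (sqrtSeries (η : ℂ)⁻¹ * G) ^ 2 := by
    rw [mul_pow, sqrtSeries_sq, hG, ← map_pow, hV]
    ext n
    rw [PowerSeries.coeff_map, Polynomial.coeff_coe, ← Polynomial.coeff_map,
      ← Polynomial.coeff_coe]
    congr 1
    simp
  -- Square roots in a domain are unique up to sign; the sign is moved into `G`.
  obtain ⟨G, hG, hs, hVG⟩ : ∃ G : PowerSeries ℂ, G ^ 2 = (ψ.map (algebraMap ℝ ℂ) : ℂ[X]) ∧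
      (Summable fun n => ‖PowerSeries.coeff n G * (r : ℂ) ^ n‖) ∧
      PowerSeries.map (algebraMap ℝ ℂ) V = sqrtSeries (η : ℂ)⁻¹ * G := by
    rcases sq_eq_sq_iff_eq_or_eq_neg.1 hVC with h | h
    · exact ⟨G, hG, hs, h⟩
    · exact ⟨-G, by rw [neg_sq, hG], by simpa using hs, by rw [h, mul_neg]⟩
  have hlim := tendsto_coeff_sqrtSeries_mul hη hr' hs
  have hsη : Summable fun n => ‖PowerSeries.coeff n G * (η : ℂ) ^ n‖ := by
    refine Summable.of_nonneg_of_le (fun _ => norm_nonneg _) (fun n => ?_) hs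
    simp only [norm_mul, norm_pow, Complex.norm_real, Real.norm_eq_abs, abs_of_pos hη,
      abs_of_pos (hη.trans hr')]
    gcongr
  have hsq := (PowerSeries.summable_norm_coeff_mul hsη hsη).2
  rw [← sq, ← sq, hG] at hsq
  simp only [Polynomial.coeff_coe, Polynomial.tsum_coeff_mul_pow] at hsq
  set T := ∑' n, PowerSeries.coeff n G * (η : ℂ) ^ n
  have hcast : ∀ n, PowerSeries.coeff n (sqrtSeries (η : ℂ)⁻¹ * G) * (η : ℂ) ^ n / sqrtCoeff n =
      ((PowerSeries.coeff n V * η ^ n / sqrtCoeff n : ℝ) : ℂ) := by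
    intro n
    rw [← hVG, PowerSeries.coeff_map]
    simp
  simp only [hcast] at hlim
  have hre : Tendsto (fun n => PowerSeries.coeff n V * η ^ n / sqrtCoeff n) atTop (𝓝 T.re) := by
    exact ((Complex.continuous_re.tendsto _).comp hlim).congr fun n => Complex.ofReal_re _
  have him : T.im = 0 := by
    have := (Complex.continuous_im.tendsto _).comp hlim
    exact tendsto_nhds_unique (this.congr fun n => Complex.ofReal_im _) tendsto_const_nhds
  -- The sign of the square root is decided here: both the coefficients of `V` and those of `√(1 -
  -- z)` are eventually nonpositive, so the limit is the nonnegative root of `ψ(η)`.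
  have hre0 : 0 ≤ T.re := by
    refine ge_of_tendsto hre ?_
    filter_upwards [hneg, eventually_ge_atTop 1] with n h1 h2
    obtain ⟨m, rfl⟩ : ∃ m, n = m + 1 := ⟨n - 1, by omega⟩
    exact div_nonneg_of_nonpos (mul_nonpos_of_nonpos_of_nonneg h1 (by positivity))
      (sqrtCoeff_succ_neg m).le
  have hT : T = (T.re : ℂ) := Complex.ext rfl (by simp [him])
  have hT2 : T.re ^ 2 = ψ.eval η := by
    rw [hT] at hsq
    have h : eval (η : ℂ) (ψ.map (algebraMap ℝ ℂ)) = ((ψ.eval η : ℝ) : ℂ) :=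
      eval_map_apply (algebraMap ℝ ℂ) η
    rw [h] at hsq
    exact_mod_cast hsq
  rwa [← hT2, Real.sqrt_sq hre0]

/-! ### Location of the roots of the discriminant -/

/-- On the unit circle this is `1 - cos mθ ≤ m²(1 - cos θ)`. In the induction, `1 - u^(m+1) = (1 -
u^m) + (1 - u) - (1 - u^m)(1 - u)`. The product has norm at most `m|1 - u|² ≤ 2m Re(1 - u)`, and `m²
+ 1 + 2m = (m + 1)²`. -/
theorem Complex.re_one_sub_pow_le {u : ℂ} (hu : ‖u‖ ≤ 1) (m : ℕ) :
    (1 - u ^ m).re ≤ (m : ℝ) ^ 2 * (1 - u).re := by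
  have hpow : ∀ m : ℕ, ‖1 - u ^ m‖ ≤ m * ‖1 - u‖ := by
    intro m
    induction m with
    | zero => simp
    | succ m ih =>
      have h1 : 1 - u ^ (m + 1) = (1 - u) + u * (1 - u ^ m) := by ring
      rw [h1]
      refine (norm_add_le _ _).trans ?_
      rw [norm_mul]
      have := mul_le_mul hu ih (norm_nonneg _) zero_le_one
      push_cast
      linarith
  have hsq : ‖1 - u‖ ^ 2 ≤ 2 * (1 - u).re := by
    have h1 : ‖u‖ ^ 2 ≤ 1 := pow_le_one₀ (norm_nonneg _) hu
    rw [Complex.sq_norm, Complex.normSq_apply] at h1 ⊢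
    simp only [Complex.sub_re, Complex.one_re, Complex.sub_im, Complex.one_im]
    nlinarith
  induction m with
  | zero => simp
  | succ m ih =>
    have h1 : 1 - u ^ (m + 1) = (1 - u ^ m) + (1 - u) - (1 - u ^ m) * (1 - u) := by ring
    have h2 : -((1 - u ^ m) * (1 - u)).re ≤ m * ‖1 - u‖ * ‖1 - u‖ := by
      refine (neg_le_abs _).trans ((Complex.abs_re_le_norm _).trans ?_)
      rw [norm_mul]
      exact mul_le_mul_of_nonneg_right (hpow m) (norm_nonneg _)
    have h3 : (m : ℝ) * ‖1 - u‖ * ‖1 - u‖ ≤ m * (2 * (1 - u).re) := by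
      rw [mul_assoc, ← sq]
      gcongr
    rw [h1, Complex.sub_re, Complex.add_re]
    push_cast
    nlinarith

namespace RegExp

theorem patternCount_pos (k : ℕ) : 0 < patternCount k :=
  Nat.mul_pos (Nat.choose_pos (by omega)) (Nat.factorial_pos _)

/-- `C_(m+1)` is the falling factorial `2m(2m - 1)⋯(m + 1) ≤ (2m)^m`, while `8m x² ≤ 1`. The spare
factor `4^m` later beats a factor linear in `m`. -/
theorem patternCount_mul_pow_le {m : ℕ} {x : ℝ} (hx : x ^ 2 * (8 + 8 * ((m : ℝ) + 1)) ≤ 1) :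
    (patternCount (m + 1) : ℝ) * x ^ (2 * (m + 1)) * 4 ^ m ≤ x ^ 2 := by
  have h1 : patternCount (m + 1) ≤ (2 * m) ^ m := by
    rw [patternCount, show 2 * (m + 1) - 2 = 2 * m by omega, Nat.add_sub_cancel, mul_comm,
      ← Nat.descFactorial_eq_factorial_mul_choose]
    exact Nat.descFactorial_le_pow _ _
  have h2 : (patternCount (m + 1) : ℝ) ≤ (2 * m) ^ m := by exact_mod_cast h1
  have h3 : x ^ 2 * (8 * m) ≤ 1 := by nlinarith [sq_nonneg x]
  calc (patternCount (m + 1) : ℝ) * x ^ (2 * (m + 1)) * 4 ^ m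
      = (patternCount (m + 1) : ℝ) * (x ^ 2) ^ m * 4 ^ m * x ^ 2 := by
        rw [pow_mul, pow_succ]; ring
    _ ≤ (2 * m) ^ m * (x ^ 2) ^ m * 4 ^ m * x ^ 2 := by gcongr
    _ = (x ^ 2 * (8 * m)) ^ m * x ^ 2 := by
        rw [← mul_pow, ← mul_pow]; ring
    _ ≤ 1 * x ^ 2 := by
        gcongr
        exact pow_le_one₀ (by positivity) h3
    _ = x ^ 2 := one_mul _

theorem patternCount_mul_pow_le_sq {k : ℕ} (hk : 1 ≤ k) {x : ℝ}
    (hx : x ^ 2 * (8 + 8 * (k : ℝ)) ≤ 1) : (patternCount k : ℝ) * x ^ (2 * k) ≤ x ^ 2 := by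
  obtain ⟨m, rfl⟩ : ∃ m, k = m + 1 := ⟨k - 1, by omega⟩
  push_cast at hx
  refine le_trans ?_ (patternCount_mul_pow_le hx)
  exact le_mul_of_one_le_right (mul_nonneg (Nat.cast_nonneg _) (by rw [pow_mul]; positivity))
    (one_le_pow₀ (by norm_num))

theorem eval_discr (k : ℕ) (x : ℝ) : (discr k).eval x =
    1 - 2 * x - (7 + 8 * k) * x ^ 2 + 4 * x * (patternCount k * x ^ (2 * k)) *
      (1 - x - x * (patternCount k * x ^ (2 * k))) := by
  simp only [discr, pPoly, hPoly, eval_add, eval_sub, eval_mul, eval_pow, eval_X, eval_C,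
    eval_one, eval_ofNat]
  ring

theorem eval_derivative_discr (k : ℕ) (x : ℝ) : (derivative (discr k)).eval x =
    -2 - 2 * (7 + 8 * k) * x + 4 * (2 * k + 1) * (patternCount k * x ^ (2 * k)) *
      (1 - x - x * (patternCount k * x ^ (2 * k))) + 4 * x * (patternCount k * x ^ (2 * k)) *
      (-1 - (2 * k + 1) * (patternCount k * x ^ (2 * k))) := by
  simp [discr, pPoly, hPoly, derivative_pow]
  ring

/-- The discriminant as a difference of squares. -/
theorem aeval_discr (k : ℕ) (z : ℂ) : aeval z (discr k) =
    (1 - z + 2 * patternCount k * z ^ (2 * k + 1)) ^ 2 -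
      8 * z ^ 2 * (k + 1 + patternCount k ^ 2 * z ^ (4 * k)) := by
  simp [discr, pPoly, hPoly, map_ofNat (aeval z)]
  ring

/-- The only positive contribution is at most `4(2k + 1)C_k x^(2k) ≤ (8k + 4)x² ≤ 1`, which cannot
outweigh the constant `-2`. -/
theorem eval_derivative_discr_neg {k : ℕ} (hk : 1 ≤ k) {x : ℝ} (h0 : 0 ≤ x)
    (hx : x ^ 2 * (8 + 8 * (k : ℝ)) ≤ 1) : (derivative (discr k)).eval x < 0 := by
  rw [eval_derivative_discr]
  have hq := patternCount_mul_pow_le_sq hk hx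
  have hq0 : 0 ≤ (patternCount k : ℝ) * x ^ (2 * k) := by positivity
  set q := (patternCount k : ℝ) * x ^ (2 * k)
  have hk0 : (0 : ℝ) ≤ k := k.cast_nonneg
  have h1 : 4 * (2 * k + 1) * q ≤ 1 := by
    have : (k : ℝ) * q ≤ k * x ^ 2 := by gcongr
    nlinarith
  have h2 : 4 * (2 * k + 1) * q * (1 - x - x * q) ≤ 4 * (2 * k + 1) * q * 1 := by
    gcongr
    have := mul_nonneg h0 hq0
    linarith
  have h3 : 0 ≤ 4 * x * q * (1 + (2 * k + 1) * q) := by positivity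
  have h4 : 0 ≤ 2 * (7 + 8 * (k : ℝ)) * x := by positivity
  linarith

/-- The right end of the interval that contains the root of the discriminant. -/
theorem sq_mul_le_one_iff (k : ℕ) {x : ℝ} (hx : 0 ≤ x) :
    x ^ 2 * (8 + 8 * (k : ℝ)) ≤ 1 ↔ x ≤ 1 / Real.sqrt (8 + 8 * (k : ℝ)) := by
  have hpos : (0 : ℝ) < 8 + 8 * k := by positivity
  have hs := Real.sqrt_pos.2 hpos
  rw [le_div_iff₀ hs, ← abs_of_nonneg (mul_nonneg hx hs.le), ← sq_le_one_iff_abs_le_one, mul_pow,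
    Real.sq_sqrt hpos.le]

theorem strictAntiOn_eval_discr {k : ℕ} (hk : 1 ≤ k) :
    StrictAntiOn (fun x => (discr k).eval x) (Set.Icc 0 (1 / Real.sqrt (8 + 8 * (k : ℝ)))) := by
  refine strictAntiOn_of_deriv_neg (convex_Icc _ _) (discr k).continuous.continuousOn ?_
  intro x hx
  rw [interior_Icc] at hx
  rw [Polynomial.deriv]
  exact eval_derivative_discr_neg hk hx.1.le ((sq_mul_le_one_iff k hx.1.le).2 hx.2.le)

theorem four_le_sqrt {k : ℕ} (hk : 1 ≤ k) : 4 ≤ Real.sqrt (8 + 8 * (k : ℝ)) := by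
  have : (1 : ℝ) ≤ k := by exact_mod_cast hk
  exact Real.le_sqrt_of_sq_le (by linarith)

/-- At this point `p_k(x) = x² - 2x`. Since `x ≤ 1/4` and `C_k x^(2k) ≤ 1/16`, the square and the
perturbation are each at most `x/4`. -/
theorem eval_discr_inv_sqrt_neg {k : ℕ} (hk : 1 ≤ k) :
    (discr k).eval (1 / Real.sqrt (8 + 8 * (k : ℝ))) < 0 := by
  have hs := four_le_sqrt hk
  set s := Real.sqrt (8 + 8 * (k : ℝ)) with hsdef
  have hs2 : s ^ 2 = 8 + 8 * k := Real.sq_sqrt (by positivity)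
  have hx0 : 0 < 1 / s := by positivity
  have hx4 : 1 / s ≤ 1 / 4 := one_div_le_one_div_of_le (by norm_num) hs
  have hx1 : (1 / s) ^ 2 * (8 + 8 * (k : ℝ)) = 1 := by
    rw [← hs2]
    field_simp
  have hq := patternCount_mul_pow_le_sq hk hx1.le
  rw [eval_discr]
  set x := 1 / s
  have hq0 : 0 ≤ (patternCount k : ℝ) * x ^ (2 * k) := by positivity
  set q := (patternCount k : ℝ) * x ^ (2 * k)
  have h1 : 4 * x * q * (1 - x - x * q) ≤ 4 * x * q * 1 := by
    gcongr
    have := mul_nonneg hx0.le hq0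
    linarith
  have h2 : q ≤ 1 / 16 := by nlinarith
  have h3 : x * q ≤ x * (1 / 16) := by gcongr
  have h4 : x ^ 2 ≤ x * (1 / 4) := by nlinarith
  nlinarith

theorem rho_pos (k : ℕ) : 0 < rho k := by
  rw [rho]
  positivity

theorem rho_lt {k : ℕ} (hk : 1 ≤ k) : rho k < 1 / Real.sqrt (8 + 8 * (k : ℝ)) :=
  one_div_lt_one_div_of_lt (by linarith [four_le_sqrt hk]) (by linarith)

/-- With `s = √(8 + 8k)`, the factors are `1 - (1 + s)z` and `1 + (s - 1)z`; the second is the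
cofactor `ψ` in the asymptotics of `RE`. -/
theorem pPoly_eq (k : ℕ) : pPoly k =
    (1 - C (1 / rho k) * X) * (1 + C (Real.sqrt (8 + 8 * (k : ℝ)) - 1) * X) := by
  have hs2 : Real.sqrt (8 + 8 * (k : ℝ)) ^ 2 = 8 + 8 * k := Real.sq_sqrt (by positivity)
  have h : (7 + 8 * (k : ℝ)) =
      (1 + Real.sqrt (8 + 8 * (k : ℝ))) * (Real.sqrt (8 + 8 * (k : ℝ)) - 1) := by
    linear_combination -hs2
  rw [pPoly, h, rho, one_div_one_div]
  simp only [C_add, C_sub, C_mul, C_1]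
  ring

/-- `p_k` vanishes at `ρ_k`, and the perturbation that is left is positive. -/
theorem eval_discr_rho_pos {k : ℕ} (hk : 1 ≤ k) : 0 < (discr k).eval (rho k) := by
  have h0 := rho_pos k
  have hlt := rho_lt hk
  have hx4 : 1 / Real.sqrt (8 + 8 * (k : ℝ)) ≤ 1 / 4 :=
    one_div_le_one_div_of_le (by norm_num) (four_le_sqrt hk)
  have hq := patternCount_mul_pow_le_sq hk ((sq_mul_le_one_iff k h0.le).2 hlt.le)
  have hp : (pPoly k).eval (rho k) = 0 := by
    rw [pPoly_eq]
    simp [h0.ne']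
  have hp' : 1 - 2 * rho k - (7 + 8 * k) * rho k ^ 2 = 0 := by
    rw [← hp]
    simp [pPoly]
  rw [eval_discr, hp', zero_add]
  have hc : (0 : ℝ) < patternCount k := by exact_mod_cast patternCount_pos k
  refine mul_pos (by positivity) ?_
  nlinarith

/-- A bound for the root of the discriminant, which gives the dominance of that root. -/
theorem patternCount_mul_pow_lt_one {k : ℕ} (hk : 1 ≤ k) {η : ℝ} (h0 : 0 < η)
    (hη : η < 1 / Real.sqrt (8 + 8 * (k : ℝ))) (hroot : (discr k).eval η = 0) :
    2 * (2 * k + 1) ^ 2 * (patternCount k * η ^ (2 * k)) < 1 := by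
  have hx := (sq_mul_le_one_iff k h0.le).2 hη.le
  rcases hk.eq_or_lt with rfl | hk2
  · have hc : patternCount 1 = 1 := by simp [patternCount]
    rw [eval_discr, hc] at hroot
    rw [hc]
    norm_num at hroot hx ⊢
    by_contra! h
    nlinarith [mul_pos h0 h0, mul_pos h0 (mul_pos h0 h0), pow_pos h0 4, pow_pos h0 5, pow_pos h0 6]
  · obtain ⟨m, rfl⟩ : ∃ m, k = m + 1 := ⟨k - 1, by omega⟩
    -- With `q = C_k η^(2k)` this gives `8(m + 2)² q < 8(m + 2)η² ≤ 1`, and `2(2k + 1)² = 8(m + 2)²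
    -- - (8m + 14)`.
    have hm : m + 2 < 4 ^ m := by
      have hm1 : 1 ≤ m := by omega
      clear * - hm1
      induction m, hm1 using Nat.le_induction with
      | base => norm_num
      | succ m hm ih => rw [pow_succ]; omega
    have hm' : (m : ℝ) + 2 < 4 ^ m := by exact_mod_cast hm
    push_cast at hx ⊢
    have hq := patternCount_mul_pow_le hx
    have hq0 : 0 < (patternCount (m + 1) : ℝ) * η ^ (2 * (m + 1)) :=
      mul_pos (by exact_mod_cast patternCount_pos _) (by positivity)
    set q := (patternCount (m + 1) : ℝ) * η ^ (2 * (m + 1))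
    have h1 : q * (m + 2) < q * 4 ^ m := by gcongr
    have h2 : 8 * (m + 2) * (q * (m + 2)) < 8 * (m + 2) * η ^ 2 :=
      mul_lt_mul_of_pos_left (h1.trans_le hq) (by positivity)
    have hm0 : (0 : ℝ) ≤ m := m.cast_nonneg
    have h3 : 0 ≤ q * (8 * m + 14) := by positivity
    nlinarith

/-- The root `η` is the only complex root of the discriminant in the disc of radius `η`. -/
theorem eq_of_aeval_discr_eq_zero {k : ℕ} (hk : 1 ≤ k) {η : ℝ} (h0 : 0 < η)
    (hη : η < 1 / Real.sqrt (8 + 8 * (k : ℝ))) (hroot : (discr k).eval η = 0) {z : ℂ}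
    (hz : aeval z (discr k) = 0) (hnorm : ‖z‖ ≤ η) : z = η := by
  have hx4 : 1 / Real.sqrt (8 + 8 * (k : ℝ)) ≤ 1 / 4 :=
    one_div_le_one_div_of_le (by norm_num) (four_le_sqrt hk)
  have hlt := patternCount_mul_pow_lt_one hk h0 hη hroot
  have hηC : (η : ℂ) ≠ 0 := by exact_mod_cast h0.ne'
  obtain ⟨u, rfl⟩ : ∃ u : ℂ, z = η * u := ⟨z / η, by field_simp⟩
  have hu : ‖u‖ ≤ 1 := by
    rw [norm_mul, Complex.norm_real, Real.norm_eq_abs, abs_of_pos h0] at hnorm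
    exact le_of_mul_le_mul_left (by linarith) h0
  have hb0 : 0 ≤ 1 - η + 2 * patternCount k * η ^ (2 * k + 1) := by
    have : 0 ≤ 2 * (patternCount k : ℝ) * η ^ (2 * k + 1) := by positivity
    linarith
  have hreal : (1 - η + 2 * patternCount k * η ^ (2 * k + 1)) ^ 2 =
      8 * η ^ 2 * (k + 1 + patternCount k ^ 2 * η ^ (4 * k)) := by
    rw [eval_discr] at hroot
    linear_combination hroot
  rw [aeval_discr, sub_eq_zero] at hz
  -- At a root, `a(z)²` equals a polynomial with nonnegative coefficients, whose modulus on the disc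
  -- is at most its value at `η`, namely `a(η)²`.
  have hle : ‖1 - η * u + 2 * patternCount k * (η * u) ^ (2 * k + 1)‖ ≤
      1 - η + 2 * patternCount k * η ^ (2 * k + 1) := by
    refine le_of_sq_le_sq ?_ hb0
    rw [← norm_pow, hz, hreal]
    have h1 : ‖(η * u : ℂ)‖ ^ 2 ≤ η ^ 2 := by gcongr
    have h2 : ‖(η * u : ℂ)‖ ^ (4 * k) ≤ η ^ (4 * k) := by gcongr
    rw [norm_mul, norm_mul, norm_pow, RCLike.norm_ofNat]
    gcongr
    refine (norm_add_le _ _).trans ?_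
    rw [norm_mul, norm_pow, norm_pow, RCLike.norm_natCast]
    have h3 : ‖(k : ℂ) + 1‖ = k + 1 := by
      have := RCLike.norm_natCast (K := ℂ) (k + 1)
      push_cast at this
      exact this
    rw [h3]
    gcongr
  have hre := (Complex.re_le_norm _).trans hle
  -- For `z = ηu`, `Re a(z) - a(η)` is `η Re(1 - u)` minus `2C_k η^(2k+1) Re(1 - u^(2k+1))`. The
  -- second term is at most a fraction of the first smaller than 1, so `Re a(z) ≤ a(η)` forces `Re u
  -- ≥ 1`, hence `u = 1`.
  have hre' : (1 - η * u + 2 * patternCount k * (η * u) ^ (2 * k + 1)).re =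
      1 - η + η * (1 - u).re + 2 * patternCount k * η ^ (2 * k + 1) *
        (1 - (1 - u ^ (2 * k + 1)).re) := by
    have : (1 - η * u + 2 * patternCount k * (η * u) ^ (2 * k + 1) : ℂ) =
      ((1 - η : ℝ) : ℂ) + (η : ℝ) * (1 - u) + ((2 * patternCount k * η ^ (2 * k + 1) : ℝ) : ℂ) *
        (1 - (1 - u ^ (2 * k + 1))) := by
      push_cast
      ring
    rw [this, Complex.add_re, Complex.add_re, Complex.re_ofReal_mul, Complex.re_ofReal_mul,
      Complex.ofReal_re, Complex.sub_re 1 (1 - _), Complex.one_re]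
  rw [hre'] at hre
  have hpow := Complex.re_one_sub_pow_le hu (2 * k + 1)
  have hc : 0 ≤ 2 * (patternCount k : ℝ) * η ^ (2 * k + 1) := by positivity
  have h1 := mul_le_mul_of_nonneg_left hpow hc
  have h2 : η * ((1 - 2 * (2 * k + 1) ^ 2 * (patternCount k * η ^ (2 * k))) * (1 - u).re) ≤ 0 := by
    push_cast at h1
    rw [pow_succ η (2 * k)] at h1 hre
    nlinarith
  have h3 : (1 - u).re ≤ 0 := by
    by_contra! h
    have := mul_pos h0 (mul_pos (sub_pos.2 hlt) h)
    linarith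
  have h4 : 1 ≤ u.re := by
    rw [Complex.sub_re, Complex.one_re] at h3
    linarith
  have h5 : u = 1 := by
    have h6 : ‖u‖ ^ 2 ≤ 1 := pow_le_one₀ (norm_nonneg _) hu
    rw [Complex.sq_norm, Complex.normSq_apply] at h6
    refine Complex.ext ?_ ?_
    · rw [Complex.one_re]
      nlinarith [mul_self_nonneg u.im]
    · rw [Complex.one_im]
      exact mul_self_eq_zero.1 (le_antisymm (by nlinarith) (mul_self_nonneg _))
  rw [h5, mul_one]

end RegExp

/-! ### Asymptotics of the two counts -/

namespace RegExp

/-- The square root of `pPoly` that appears in the solution for `seriesRE`. -/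
theorem sq_eq_pPoly (k : ℕ) :
    (1 - PowerSeries.X - 4 * PowerSeries.X * seriesRE k) ^ 2 = (pPoly k : PowerSeries ℝ) := by
  have h := seriesRE_eq k
  have hp : (pPoly k : PowerSeries ℝ) = 1 - 2 * PowerSeries.X -
      (7 + 8 * PowerSeries.C (k : ℝ)) * PowerSeries.X ^ 2 := by
    have hn (n : ℕ) : ((n : ℝ[X]) : PowerSeries ℝ) = n :=
      map_natCast (coeToPowerSeries.ringHom (R := ℝ)) n
    have h2 : ((2 : ℝ[X]) : PowerSeries ℝ) = 2 := map_ofNat (coeToPowerSeries.ringHom (R := ℝ)) 2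
    have h7 : (PowerSeries.C 7 : PowerSeries ℝ) = 7 := map_ofNat _ 7
    have h8 : (PowerSeries.C 8 : PowerSeries ℝ) = 8 := map_ofNat _ 8
    simp [pPoly, hn, h2, h7, h8]
  rw [hp]
  rw [map_add, map_one] at h
  linear_combination (-8 * PowerSeries.X) * h

/-- The square root of `discr` that appears in the solution for `seriesREna`. -/
theorem sq_eq_discr {k : ℕ} (hk : 1 ≤ k) :
    (1 - PowerSeries.X + 2 * PowerSeries.C (patternCount k : ℝ) * PowerSeries.X ^ (2 * k + 1) -
      4 * PowerSeries.X * seriesREna k) ^ 2 = (discr k : PowerSeries ℝ) := by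
  have h := seriesREna_eq hk
  have hp : (discr k : PowerSeries ℝ) = 1 - 2 * PowerSeries.X -
      (7 + 8 * PowerSeries.C (k : ℝ)) * PowerSeries.X ^ 2 +
      4 * PowerSeries.X ^ (2 * k + 1) * PowerSeries.C (patternCount k : ℝ) *
      (1 - PowerSeries.X - PowerSeries.C (patternCount k : ℝ) * PowerSeries.X ^ (2 * k + 1)) := by
    have hn (n : ℕ) : ((n : ℝ[X]) : PowerSeries ℝ) = n :=
      map_natCast (coeToPowerSeries.ringHom (R := ℝ)) n
    have h2 : ((2 : ℝ[X]) : PowerSeries ℝ) = 2 := map_ofNat (coeToPowerSeries.ringHom (R := ℝ)) 2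
    have h4 : ((4 : ℝ[X]) : PowerSeries ℝ) = 4 := map_ofNat (coeToPowerSeries.ringHom (R := ℝ)) 4
    have h7 : (PowerSeries.C 7 : PowerSeries ℝ) = 7 := map_ofNat _ 7
    have h8 : (PowerSeries.C 8 : PowerSeries ℝ) = 8 := map_ofNat _ 8
    simp [discr, hPoly, pPoly, hn, h2, h4, h7, h8]
  rw [hp]
  rw [map_add, map_one] at h
  -- Completing the square in `2zR² - (1 - z + 2zP)R + z(k + 1 + P²) = 0` after multiplication by
  -- `8z`.
  linear_combination (-8 * PowerSeries.X) * h

theorem coeff_sqrt_pPoly (k : ℕ) {n : ℕ} (hn : 1 ≤ n) :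
    PowerSeries.coeff (n + 1) (1 - PowerSeries.X - 4 * PowerSeries.X * seriesRE k) =
      -4 * (countRE k n : ℝ) := by
  rw [show (4 : PowerSeries ℝ) = PowerSeries.C 4 from (map_ofNat _ 4).symm, mul_assoc, map_sub,
    PowerSeries.coeff_C_mul, PowerSeries.coeff_succ_X_mul, seriesRE, PowerSeries.coeff_mk]
  simp [PowerSeries.coeff_one, PowerSeries.coeff_X, show n ≠ 0 by omega]

/-- The lower bound on `n` puts the index beyond the polynomial part, whose last term has degree `2k
+ 1`. The factor `z` in front of the series shifts the index, whence the exponent `n + 1` in the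
final ratio. -/
theorem coeff_sqrt_discr (k : ℕ) {n : ℕ} (hn : 2 * k + 1 ≤ n) :
    PowerSeries.coeff (n + 1) (1 - PowerSeries.X + 2 * PowerSeries.C (patternCount k : ℝ) *
      PowerSeries.X ^ (2 * k + 1) - 4 * PowerSeries.X * seriesREna k) =
      -4 * (countREna k n : ℝ) := by
  rw [show (4 : PowerSeries ℝ) = PowerSeries.C 4 from (map_ofNat _ 4).symm,
    show (2 : PowerSeries ℝ) = PowerSeries.C 2 from (map_ofNat _ 2).symm, mul_assoc, mul_assoc,
    map_sub, map_add, PowerSeries.coeff_C_mul, PowerSeries.coeff_C_mul, PowerSeries.coeff_C_mul,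
    PowerSeries.coeff_succ_X_mul, seriesREna, PowerSeries.coeff_mk]
  simp [PowerSeries.coeff_one, PowerSeries.coeff_X, PowerSeries.coeff_X_pow,
    show n ≠ 0 by omega, show n ≠ 2 * k by omega]

theorem tendsto_countRE {k : ℕ} (hk : 1 ≤ k) :
    Tendsto (fun n => -4 * (countRE k n : ℝ) * rho k ^ (n + 1) / sqrtCoeff (n + 1)) atTop
      (𝓝 (Real.sqrt (2 - 2 * rho k))) := by
  have hs := four_le_sqrt hk
  have hρ := rho_pos k
  have hval : (1 + C (Real.sqrt (8 + 8 * (k : ℝ)) - 1) * X : ℝ[X]).eval (rho k) =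
      2 - 2 * rho k := by
    simp only [eval_add, eval_one, eval_mul, eval_C, eval_X, rho]
    field_simp
    ring
  have hlt : rho k < 1 := (rho_lt hk).trans_le (by
    rw [div_le_one (by linarith)]
    linarith)
  have h := tendsto_coeff_of_sq_eq (ψ := 1 + C (Real.sqrt (8 + 8 * (k : ℝ)) - 1) * X) hρ
    (by simp) (fun z hz => ?_) (by rw [hval]; linarith)
    ((sq_eq_pPoly k).trans (by rw [pPoly_eq])) ?_
  · rw [hval] at h
    refine (h.comp (tendsto_add_atTop_nat 1)).congr' ?_
    filter_upwards [eventually_ge_atTop 1] with n hn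
    rw [Function.comp, coeff_sqrt_pPoly k hn]
  -- The cofactor has the single root `-1/(s - 1)`, with `s = √(8 + 8k)`; it is farther from 0 than
  -- `ρ_k = 1/(1 + s)`.
  · have h1 : (1 : ℂ) + ((Real.sqrt (8 + 8 * (k : ℝ)) - 1 : ℝ) : ℂ) * z = 0 := by
      rw [← hz]
      simp
    have h2 : (Real.sqrt (8 + 8 * (k : ℝ)) - 1) * ‖z‖ = 1 := by
      have h3 := congrArg norm (eq_neg_of_add_eq_zero_right h1)
      rwa [norm_mul, Complex.norm_real, Real.norm_eq_abs, abs_of_pos (by linarith), norm_neg,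
        norm_one] at h3
    rw [rho, div_lt_iff₀ (by linarith)]
    have hz0 : 0 < ‖z‖ := by
      by_contra! h4
      nlinarith [norm_nonneg z]
    nlinarith
  · filter_upwards [eventually_ge_atTop 2] with n hn
    obtain ⟨m, rfl⟩ : ∃ m, n = m + 1 := ⟨n - 1, by omega⟩
    rw [coeff_sqrt_pPoly k (by omega)]
    have : (0 : ℝ) ≤ countRE k m := Nat.cast_nonneg _
    linarith

theorem tendsto_countREna {k : ℕ} (hk : 1 ≤ k) {η : ℝ} {ψ : ℝ[X]} (h0 : 0 < η)
    (hη : η < 1 / Real.sqrt (8 + 8 * (k : ℝ))) (hψ : discr k = (1 - C (1 / η) * X) * ψ)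
    (hpos : 0 < ψ.eval η) :
    Tendsto (fun n => -4 * (countREna k n : ℝ) * η ^ (n + 1) / sqrtCoeff (n + 1)) atTop
      (𝓝 (Real.sqrt (ψ.eval η))) := by
  have hroot : (discr k).eval η = 0 := by
    rw [hψ]
    simp [h0.ne']
  have h := tendsto_coeff_of_sq_eq h0 (ψ := ψ) ?_ (fun z hz => ?_) hpos
    ((sq_eq_discr hk).trans (by rw [hψ])) ?_
  · refine (h.comp (tendsto_add_atTop_nat 1)).congr' ?_
    filter_upwards [eventually_ge_atTop (2 * k + 1)] with n hn
    rw [Function.comp, coeff_sqrt_discr k hn]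
  · have h1 := congrArg (eval 0) hψ
    rw [eval_discr] at h1
    rw [coeff_zero_eq_eval_zero]
    simpa using h1.symm
  -- A root of `ψ` in the closed disc would be a root of `Δ_k`, hence equal to `η`, where `ψ` is
  -- positive.
  · by_contra! hle
    have hz' : aeval z (discr k) = 0 := by rw [hψ, map_mul, hz, mul_zero]
    rw [eq_of_aeval_discr_eq_zero hk h0 hη hroot hz' hle] at hz
    have h2 : ((ψ.eval η : ℝ) : ℂ) = 0 := by
      rw [← hz]
      exact (aeval_algebraMap_apply_eq_algebraMap_eval η ψ).symm
    exact hpos.ne' (by exact_mod_cast h2)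
  · filter_upwards [eventually_ge_atTop (2 * k + 2)] with n hn
    obtain ⟨m, rfl⟩ : ∃ m, n = m + 1 := ⟨n - 1, by omega⟩
    rw [coeff_sqrt_discr k (by omega)]
    have : (0 : ℝ) ≤ countREna k m := Nat.cast_nonneg _
    linarith

theorem exists_root_discr {k : ℕ} (hk : 1 ≤ k) :
    ∃ η ∈ Set.Ioo (0 : ℝ) (1 / Real.sqrt (8 + 8 * (k : ℝ))), (discr k).eval η = 0 := by
  have hs := four_le_sqrt hk
  refine intermediate_value_Ioo' (by positivity) (discr k).continuous.continuousOn
    ⟨eval_discr_inv_sqrt_neg hk, ?_⟩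
  rw [eval_discr]
  norm_num

/-- `ψ(η) = -η Δ_k'(η)`, and the derivative is negative there. -/
theorem exists_cofactor_discr {k : ℕ} (hk : 1 ≤ k) {η : ℝ}
    (hη : η ∈ Set.Ioo (0 : ℝ) (1 / Real.sqrt (8 + 8 * (k : ℝ)))) (hroot : (discr k).eval η = 0) :
    ∃ ψ : ℝ[X], discr k = (1 - C (1 / η) * X) * ψ ∧ 0 < ψ.eval η := by
  obtain ⟨q, hq⟩ := dvd_iff_isRoot.2 hroot
  have hfac : discr k = (1 - C (1 / η) * X) * (C (-η) * q) := by
    have : (C η : ℝ[X]) * C (1 / η) = 1 := by rw [← C_mul, mul_one_div_cancel hη.1.ne', C_1]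
    rw [hq, C_neg]
    linear_combination (-X * q) * this
  refine ⟨_, hfac, ?_⟩
  have h1 := eval_derivative_discr_neg hk hη.1.le ((sq_mul_le_one_iff k hη.1.le).2 hη.2.le)
  rw [hq] at h1
  simp only [derivative_mul, derivative_sub, derivative_X, derivative_C, eval_add, eval_mul,
    eval_sub, eval_X, eval_C, sub_self, zero_mul, add_zero, sub_zero, one_mul] at h1
  simp only [eval_mul, eval_C]
  exact mul_pos_of_neg_of_neg (neg_neg_of_pos hη.1) h1

end RegExp

/-! ### The asymptotic ratio -/

theorem mainTheorem4 (k : ℕ) (hk : 1 ≤ k) :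
    ∃ (η : ℝ) (ψ : ℝ[X]),
      -- `η` is the unique root of the discriminant in the open interval
      (η ∈ Set.Ioo (0 : ℝ) (1 / Real.sqrt (8 + 8 * (k : ℝ))) ∧ (RegExp.discr k).eval η = 0 ∧
        ∀ x ∈ Set.Ioo (0 : ℝ) (1 / Real.sqrt (8 + 8 * (k : ℝ))),
          (RegExp.discr k).eval x = 0 → x = η) ∧
      -- `ψ` is the cofactor of `1 - z / η`, and the root is simple
      RegExp.discr k = (1 - C (1 / η) * X) * ψ ∧
      0 < ψ.eval η ∧
      RegExp.rho k < η ∧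
      -- the asymptotic ratio, in its two forms
      (fun n : ℕ => (RegExp.countREna k n : ℝ) / (RegExp.countRE k n : ℝ)) ~[atTop]
        (fun n : ℕ =>
          (Real.sqrt (ψ.eval η) / (8 * η * Real.sqrt Real.pi) * (n : ℝ) ^ (-(3 / 2) : ℝ)
              * (η ^ n)⁻¹) /
            (Real.sqrt (2 - 2 * RegExp.rho k) / (8 * RegExp.rho k * Real.sqrt Real.pi)
              * (n : ℝ) ^ (-(3 / 2) : ℝ) * (RegExp.rho k ^ n)⁻¹)) ∧
      (fun n : ℕ => (RegExp.countREna k n : ℝ) / (RegExp.countRE k n : ℝ)) ~[atTop]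
        (fun n : ℕ =>
          Real.sqrt (ψ.eval η) / Real.sqrt (2 - 2 * RegExp.rho k)
            * (RegExp.rho k / η) ^ (n + 1)) ∧
      Tendsto (fun n : ℕ => (RegExp.countREna k n : ℝ) / (RegExp.countRE k n : ℝ))
        atTop (𝓝 0) := by
  obtain ⟨η, hη, hroot⟩ := RegExp.exists_root_discr hk
  obtain ⟨ψ, hψ, hpos⟩ := RegExp.exists_cofactor_discr hk hη hroot
  have hanti := RegExp.strictAntiOn_eval_discr hk
  have hρ := RegExp.rho_pos k
  have hρlt := RegExp.rho_lt hk
  have hρη : RegExp.rho k < η := by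
    rw [← hanti.lt_iff_gt ⟨hη.1.le, hη.2.le⟩ ⟨hρ.le, hρlt.le⟩]
    simp only [hroot]
    exact RegExp.eval_discr_rho_pos hk
  have hη1 : η < 1 := hη.2.trans_le (by
    have := RegExp.four_le_sqrt hk
    rw [div_le_one (by linarith)]
    linarith)
  have hψ0 : 0 < Real.sqrt (ψ.eval η) := Real.sqrt_pos.2 hpos
  have hσ0 : 0 < Real.sqrt (2 - 2 * RegExp.rho k) := Real.sqrt_pos.2 (by linarith)
  have hequiv : (fun n : ℕ => (RegExp.countREna k n : ℝ) / (RegExp.countRE k n : ℝ)) ~[atTop]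
      (fun n : ℕ => Real.sqrt (ψ.eval η) / Real.sqrt (2 - 2 * RegExp.rho k)
        * (RegExp.rho k / η) ^ (n + 1)) := by
    -- Both limits are relative to the same `sqrtCoeff (n + 1)`, which cancels together with the
    -- factor `-4`.
    have h1 := (RegExp.tendsto_countREna hk hη.1 hη.2 hψ hpos).div (RegExp.tendsto_countRE hk)
      hσ0.ne'
    have h2 := ((isEquivalent_const_iff_tendsto (div_ne_zero hψ0.ne' hσ0.ne')).2 h1).mul
      (IsEquivalent.refl (u := fun n : ℕ => (RegExp.rho k / η) ^ (n + 1)))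
    refine h2.congr_left (Eventually.of_forall fun n => ?_)
    have ha := sqrtCoeff_ne_zero (n + 1)
    have hr := pow_ne_zero (n + 1) hρ.ne'
    have he := pow_ne_zero (n + 1) hη.1.ne'
    simp only [Pi.mul_apply, Pi.div_apply, div_pow]
    -- If the denominator is 0, as for `n = 0`, both sides are 0 by the convention on division.
    rcases eq_or_ne (RegExp.countRE k n : ℝ) 0 with h | h
    · simp [h]
    · field_simp
  refine ⟨η, ψ, ⟨hη, hroot, fun x hx hx0 => ?_⟩, hψ, hpos, hρη, ?_, hequiv, ?_⟩
  · exact hanti.injOn ⟨hx.1.le, hx.2.le⟩ ⟨hη.1.le, hη.2.le⟩ (hx0.trans hroot.symm)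
  · refine hequiv.congr_right ?_
    -- The case `n = 0` is excluded because `0 ^ (-3/2)` is 0 by convention and could not be
    -- cancelled.
    filter_upwards [eventually_ge_atTop 1] with n hn
    have hn : (0 : ℝ) < n := by exact_mod_cast hn
    have hN := (Real.rpow_pos_of_pos hn (-(3 / 2) : ℝ)).ne'
    have hπ := (Real.sqrt_pos.2 Real.pi_pos).ne'
    have hη0 := hη.1.ne'
    have hr := pow_ne_zero n hρ.ne'
    have he := pow_ne_zero n hη0
    rw [div_pow, pow_succ, pow_succ]
    field_simp
  · refine hequiv.symm.tendsto_nhds ?_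
    have h1 : Tendsto (fun n : ℕ => (RegExp.rho k / η) ^ n) atTop (𝓝 0) :=
      tendsto_pow_atTop_nhds_zero_of_lt_one (div_pos hρ hη.1).le ((div_lt_one hη.1).2 hρη)
    simpa using (h1.comp (tendsto_add_atTop_nat 1)).const_mul
      (Real.sqrt (ψ.eval η) / Real.sqrt (2 - 2 * RegExp.rho k))
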